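/- Let $H$ be a finite-dimensional real Hilbert space, $d=\dim H$. The demension $\operatorname{dem}(S)$ of a set $S\subset H$ is the largest integer $j$ such that there exist a piecewise linear polyhedron $P\subset H$ of dimension $d-j$ (the underlying space of a finite simplicial complex in $H$ of dimension $d-j$) and an $\varepsilon>0$ with the following property: for every continuous map $F:H\times[0,1]\to H$, with $F_t(x)=F(x,t)$, satisfying (I) $F_t$ is a homeomorphism of $H$ for each $t\in[0,1]$, and $F_0$ is the identity; (II) $\|x-F_t(x)\|\le\varepsilon$ for all $x\in H$ and $t\in[0,1]$; (III) $F_t(x)=x$ for all $t\in[0,1]$ and all $x\in H$ outside the open $\varepsilon$-neighbourhood of $P\cap S$; one has $F_1(P)\cap S\ne\emptyset$. Theorem. Let $M\subset H$ be a compact smooth ($C^\infty$, embedded) $k$-dimensional manifold-with-boundary (the boundary may be empty), and let $S\subset M$ satisfy $\operatorname{dem}(S)=k$. Then $S$ has nonempty interior relative to $M$. -/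

import Mathlib

open scoped ContDiff

/-- `P` is a (compact) piecewise linear polyhedron of dimension `n`: the underlying space of a finite
simplicial complex whose simplices of largest dimension have dimension `n`. -/
def IsPolyhedron {H : Type*} [NormedAddCommGroup H] [InnerProductSpace ℝ H]
    (n : ℕ) (P : Set H) : Prop :=
  ∃ K : Geometry.SimplicialComplex ℝ H,
    K.faces.Finite ∧ K.space = P ∧ IsGreatest {m : ℕ | ∃ s ∈ K.faces, s.card = m + 1} n

/-- `F` is an isotopy of `H` (a continuous map `H × [0,1] → H` all of whose stages are homeomorphisms
of `H` and which starts at the identity) that moves no point by more than `ε` and whose stages are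
the identity outside the set `N`. -/
structure IsSmallIsotopy {H : Type*} [NormedAddCommGroup H] [InnerProductSpace ℝ H]
    (ε : ℝ) (N : Set H) (F : H × unitInterval → H) : Prop where
  continuous : Continuous F
  isHomeomorph : ∀ t : unitInterval, IsHomeomorph (fun x : H => F (x, t))
  map_zero : ∀ x : H, F (x, 0) = x
  dist_le : ∀ (t : unitInterval) (x : H), dist x (F (x, t)) ≤ ε
  eq_self : ∀ (t : unitInterval) (x : H), x ∉ N → F (x, t) = x

/-- The condition on the integer `j` in the definition of the demension of `S`: there are a
piecewise linear polyhedron `P` of dimension `dim H - j` and an `ε > 0` such that no isotopy that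
moves points by at most `ε` and is supported in the open `ε`-neighbourhood of `P ∩ S` pushes `P`
off `S`. (No polyhedron has dimension `< 0` here; the empty set could never satisfy the
condition.) -/
def DemensionCondition {H : Type*} [NormedAddCommGroup H] [InnerProductSpace ℝ H]
    (S : Set H) (j : ℤ) : Prop :=
  ∃ (n : ℕ) (P : Set H) (ε : ℝ),
    (n : ℤ) = (Module.finrank ℝ H : ℤ) - j ∧ IsPolyhedron n P ∧ 0 < ε ∧
      ∀ F : H × unitInterval → H, IsSmallIsotopy ε (Metric.thickening ε (P ∩ S)) F →
        (((fun x : H => F (x, 1)) '' P) ∩ S).Nonempty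

/-- `dem S = k`: the integer `k` is the largest one that satisfies the condition above. (The empty
set has no integer demension.) To be used for finite-dimensional `H` only. -/
def HasDemension {H : Type*} [NormedAddCommGroup H] [InnerProductSpace ℝ H]
    (S : Set H) (k : ℤ) : Prop :=
  IsGreatest {j : ℤ | DemensionCondition S j} k

/-- `M` is a smooth (`C^∞`) `k`-dimensional embedded submanifold-with-boundary of `H`: around each
of its points there is a smooth diffeomorphism `φ` from an open subset of `H` onto an open subset of
`ℝ^k × ℝ^m` (so that `k + m = dim H`) which carries `M` either to the slice `ℝ^k × {0}` or to a
half-space `{(u, 0) | 0 ≤ u i}` of this slice. -/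
def IsSmoothSubmanifoldWithBoundary {H : Type*} [NormedAddCommGroup H] [InnerProductSpace ℝ H]
    (k : ℕ) (M : Set H) : Prop :=
  ∀ p ∈ M, ∃ (m : ℕ) (φ : OpenPartialHomeomorph H ((Fin k → ℝ) × (Fin m → ℝ))),
    p ∈ φ.source ∧ ContDiffOn ℝ ∞ φ φ.source ∧ ContDiffOn ℝ ∞ φ.symm φ.target ∧
      ((∀ x ∈ φ.source, x ∈ M ↔ (φ x).2 = 0) ∨
        ∃ i : Fin k, ∀ x ∈ φ.source, x ∈ M ↔ (φ x).2 = 0 ∧ 0 ≤ (φ x).1 i)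

/-!
Suppose that `S` has empty interior in `M`, so that `M \ S` is dense in `M`, and let `P` be a
polyhedron of dimension `d - k`. It is enough to push `P` off `S` by an arbitrarily small isotopy
supported in `U`, the open `ε`-neighbourhood of `P ∩ S` (`exists_isSmallIsotopy_disjoint`).

Choose a smooth `f ≥ 0` that is positive exactly on `U`, and let `x` move to `x + f x • v` for a small
vector `v`. Parametrize each simplex of `P` by `ℝ^(d-k)` and each of finitely many slices of charts
covering `M` by an open subset of `ℝ^k`. Then `x + f x • v = ψ u` says that the smooth map
`(u, x) ↦ (f x)⁻¹ • (ψ u - x)` between spaces of dimension `d` takes the value `v`. By Sard's theorem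
in equal dimensions and the inverse function theorem, for almost every `v` the solutions are isolated
(`exists_null_forall_eventually_eq`, `exists_vector_forall_isolated`). Hence the points of `P ∩ U`
that land on `M` form a discrete set, finite in each region `η ≤ f` with `η > 0`, though possibly
infinite near the frontier of `U`.

Each such point is next pushed along its slice to a point of `M \ S`, inside a small ball in which the
moved polyhedron meets the slice nowhere else (`exists_isotopy_push`). The balls are pairwise disjoint
and only finitely many exceed a given size, so all these isotopies can be performed at once
(`IsIsotopyWithin.exists_glue`). Points of `P` outside `U` never move, and they are not in `S`.
-/

open Set Filter Topology

/-! ### Isotopies supported in a set -/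

/-- `h` is an isotopy of `X` supported in `N`: a continuous family of bijections of `X` that starts
at the identity and whose stages are the identity outside `N`. Only bijectivity of the stages is
recorded; for bounded `N` in a finite-dimensional space they are then homeomorphisms
(`IsIsotopyWithin.isHomeomorph`). -/
structure IsIsotopyWithin {X : Type*} [TopologicalSpace X] (N : Set X)
    (h : X × unitInterval → X) : Prop where
  continuous : Continuous h
  bijective : ∀ t, Function.Bijective fun x => h (x, t)
  map_zero : ∀ x, h (x, 0) = x
  eq_self : ∀ t, ∀ x ∉ N, h (x, t) = x

namespace IsIsotopyWithin

section TopologicalSpace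

variable {X : Type*} [TopologicalSpace X] {N N' : Set X} {h g : X × unitInterval → X}

theorem mapsTo (hh : IsIsotopyWithin N h) (t : unitInterval) {x : X} (hx : x ∈ N) :
    h (x, t) ∈ N := by
  by_contra hn
  have h1 : h (h (x, t), t) = h (x, t) := hh.eq_self t _ hn
  have h2 : h (x, t) = x := (hh.bijective t).1 h1
  exact hn (h2.symm ▸ hx)

theorem mono (hh : IsIsotopyWithin N h) (hN : N ⊆ N') : IsIsotopyWithin N' h :=
  ⟨hh.continuous, hh.bijective, hh.map_zero, fun t x hx => hh.eq_self t x fun h' => hx (hN h')⟩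

theorem comp (hg : IsIsotopyWithin N g) (hh : IsIsotopyWithin N h) :
    IsIsotopyWithin N fun p : X × unitInterval => g (h p, p.2) where
  continuous := hg.continuous.comp (hh.continuous.prodMk continuous_snd)
  bijective t := (hg.bijective t).comp (hh.bijective t)
  map_zero x := by simp [hg.map_zero, hh.map_zero]
  eq_self t x hx := by simp [hh.eq_self t x hx, hg.eq_self t x hx]

end TopologicalSpace

variable {E : Type*} [NormedAddCommGroup E] {N : Set E} {h : E × unitInterval → E}

theorem isHomeomorph [ProperSpace E] (hh : IsIsotopyWithin N h) (hN : Bornology.IsBounded N)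
    (t : unitInterval) : IsHomeomorph fun x => h (x, t) := by
  have hc : Continuous fun x => h (x, t) := hh.continuous.comp (by fun_prop)
  refine isHomeomorph_iff_continuous_isClosedMap_bijective.2 ⟨hc, ?_, hh.bijective t⟩
  refine (isProperMap_iff_tendsto_cocompact.2 ⟨hc, ?_⟩).isClosedMap
  refine tendsto_id.congr' ?_
  rw [← Metric.cobounded_eq_cocompact]
  filter_upwards [Bornology.isBounded_def.1 hN] with x hx
  exact (hh.eq_self t x hx).symm

/-- Isotopies with pairwise disjoint supports can be performed simultaneously, provided that only
finitely many of the supports are larger than any given size. -/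
theorem exists_glue {ι : Type*} (N : ι → Set E) (h : ι → E × unitInterval → E)
    (hh : ∀ i, IsIsotopyWithin (N i) (h i)) (hdisj : ∀ i j, ∀ x ∈ N i, x ∈ N j → i = j)
    (r : ι → ℝ) (hr : ∀ i, ∀ x ∈ N i, ∀ y ∈ N i, dist x y ≤ r i)
    (hfin : ∀ η > 0, {i | η ≤ r i}.Finite) :
    ∃ G : E × unitInterval → E, IsIsotopyWithin (⋃ i, N i) G ∧
      ∀ i, ∀ x ∈ N i, ∀ t, G (x, t) = h i (x, t) := by
  classical
  let G : E × unitInterval → E :=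
    fun p => if hp : ∃ i, p.1 ∈ N i then h hp.choose p else p.1
  have hG : ∀ i, ∀ x ∈ N i, ∀ t, G (x, t) = h i (x, t) := by
    intro i x hx t
    have hp : ∃ i, ((x, t) : E × unitInterval).1 ∈ N i := ⟨i, hx⟩
    have : hp.choose = i := hdisj _ _ x hp.choose_spec hx
    simp only [G, dif_pos hp, this]
  have hG' : ∀ t, ∀ x ∉ ⋃ i, N i, G (x, t) = x := by
    intro t x hx
    have hp : ¬ ∃ i, ((x, t) : E × unitInterval).1 ∈ N i := by simpa using hx
    simp only [G, dif_neg hp]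
  have hmem : ∀ i t x, G (x, t) ∈ N i → x ∈ N i := by
    intro i t x hx
    by_cases hxN : x ∈ ⋃ i, N i
    · obtain ⟨j, hj⟩ := mem_iUnion.1 hxN
      rw [hG j x hj t] at hx
      rwa [hdisj i j _ hx ((hh j).mapsTo t hj)]
    · rwa [hG' t x hxN] at hx
  refine ⟨G, ⟨?_, fun t => ⟨?_, ?_⟩, ?_, hG'⟩, hG⟩
  · -- Up to `η`, only the finitely many supports of size at least `η` matter.
    refine continuous_of_uniform_approx_of_continuous fun u hu => ?_
    obtain ⟨η, hη, hηu⟩ := Metric.mem_uniformity_dist.1 hu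
    let J := (hfin η hη).toFinset
    refine ⟨fun p => p.1 + ∑ i ∈ J, (h i p - p.1), ?_, ?_⟩
    · refine continuous_fst.add (continuous_finsetSum _ fun i _ => ?_)
      exact (hh i).continuous.sub continuous_fst
    · rintro ⟨x, t⟩
      apply hηu
      by_cases hx : x ∈ ⋃ i, N i
      · obtain ⟨i, hi⟩ := mem_iUnion.1 hx
        have h0 : ∀ j, j ≠ i → h j (x, t) - x = 0 := fun j hj => by
          rw [(hh j).eq_self t x fun hxj => hj (hdisj _ _ x hxj hi), sub_self]
        rw [hG i x hi t]
        change dist (h i (x, t)) (x + ∑ j ∈ J, (h j (x, t) - x)) < η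
        by_cases hiJ : i ∈ J
        · rw [Finset.sum_eq_single_of_mem i hiJ fun j _ hj => h0 j hj]
          simpa using hη
        · rw [Finset.sum_eq_zero fun j hj => h0 j fun hji => hiJ (hji ▸ hj), add_zero]
          refine (hr i _ ((hh i).mapsTo t hi) _ hi).trans_lt ?_
          simpa [J] using hiJ
      · change dist (G (x, t)) (x + ∑ j ∈ J, (h j (x, t) - x)) < η
        rw [hG' t x hx, Finset.sum_eq_zero, add_zero, dist_self]
        · exact hη
        · intro j _
          rw [(hh j).eq_self t x fun hxj => hx (mem_iUnion.2 ⟨j, hxj⟩), sub_self]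
  · intro x y hxy
    simp only at hxy
    by_cases hx : x ∈ ⋃ i, N i
    · obtain ⟨i, hi⟩ := mem_iUnion.1 hx
      have hy : y ∈ N i := hmem i t y (by rw [← hxy, hG i x hi]; exact (hh i).mapsTo t hi)
      rw [hG i x hi, hG i y hy] at hxy
      exact ((hh i).bijective t).1 hxy
    · by_cases hy : y ∈ ⋃ i, N i
      · obtain ⟨i, hi⟩ := mem_iUnion.1 hy
        have hx' : x ∈ N i := hmem i t x (by rw [hxy, hG i y hi]; exact (hh i).mapsTo t hi)
        exact absurd (mem_iUnion.2 ⟨i, hx'⟩) hx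
      · rwa [hG' t x hx, hG' t y hy] at hxy
  · intro y
    by_cases hy : y ∈ ⋃ i, N i
    · obtain ⟨i, hi⟩ := mem_iUnion.1 hy
      obtain ⟨x, hx⟩ := ((hh i).bijective t).2 y
      simp only at hx
      have hxi : x ∈ N i := by
        by_contra hxi
        rw [(hh i).eq_self t x hxi] at hx
        exact hxi (hx ▸ hi)
      exact ⟨x, by simpa only [hG i x hxi t] using hx⟩
    · exact ⟨y, hG' t y hy⟩
  · intro x
    by_cases hx : x ∈ ⋃ i, N i
    · obtain ⟨i, hi⟩ := mem_iUnion.1 hx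
      rw [hG i x hi, (hh i).map_zero]
    · exact hG' 0 x hx

end IsIsotopyWithin

/-- A perturbation of the identity with Lipschitz constant less than `1` is bijective. -/
theorem bijective_add_smul_of_lipschitzWith {E : Type*} [NormedAddCommGroup E] [NormedSpace ℝ E]
    [CompleteSpace E] {c : E → ℝ} {C : NNReal} (hc : LipschitzWith C c) {a : E}
    (ha : C * ‖a‖₊ < 1) : Function.Bijective fun x => x + c x • a := by
  have key : ApproximatesLinearOn (fun x => x + c x • a)
      ((ContinuousLinearEquiv.refl ℝ E : E ≃L[ℝ] E) : E →L[ℝ] E) univ (C * ‖a‖₊) := by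
    intro x _ y _
    have h1 := hc.dist_le_mul x y
    rw [Real.dist_eq, dist_eq_norm] at h1
    have h2 : x + c x • a - (y + c y • a) -
        ((ContinuousLinearEquiv.refl ℝ E : E ≃L[ℝ] E) : E →L[ℝ] E) (x - y) =
        (c x - c y) • a := by
      simp only [ContinuousLinearEquiv.coe_refl, ContinuousLinearMap.coe_id', id_eq, sub_smul]
      abel
    rw [h2, norm_smul, Real.norm_eq_abs, NNReal.coe_mul, coe_nnnorm]
    nlinarith [norm_nonneg a]
  have hlt : Subsingleton E ∨ C * ‖a‖₊ <
      ‖((ContinuousLinearEquiv.refl ℝ E).symm : E →L[ℝ] E)‖₊⁻¹ := by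
    rcases subsingleton_or_nontrivial E with hE | hE
    · exact Or.inl hE
    · right
      have : ‖((ContinuousLinearEquiv.refl ℝ E).symm : E →L[ℝ] E)‖₊ = 1 := by
        simp [ContinuousLinearEquiv.refl_symm]
      rwa [this, inv_one]
  exact ⟨injOn_univ.1 (key.injOn hlt), key.surjective hlt⟩

/-- The isotopy moving each point `x` along the vector `f x • a`. -/
theorem isIsotopyWithin_add_smul {E : Type*} [NormedAddCommGroup E] [NormedSpace ℝ E]
    [CompleteSpace E] {f : E → ℝ} {C : NNReal} (hf : LipschitzWith C f) {a : E}
    (ha : C * ‖a‖₊ < 1) :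
    IsIsotopyWithin (Function.support f)
      fun p : E × unitInterval => p.1 + f p.1 • ((p.2 : ℝ) • a) where
  continuous := by
    have := hf.continuous
    fun_prop
  bijective t := by
    refine bijective_add_smul_of_lipschitzWith (a := (t : ℝ) • a) hf (lt_of_le_of_lt ?_ ha)
    rw [nnnorm_smul]
    have : ‖(t : ℝ)‖₊ ≤ 1 := by
      rw [← NNReal.coe_le_coe, coe_nnnorm, Real.norm_eq_abs, abs_of_nonneg t.2.1]
      exact t.2.2
    calc C * (‖(t : ℝ)‖₊ * ‖a‖₊) ≤ C * (1 * ‖a‖₊) := by gcongr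
      _ = _ := by rw [one_mul]
  map_zero x := by simp
  eq_self t x hx := by simp [Function.notMem_support.1 hx]

/-! ### Pushing a point along a slice -/

/-- An isotopy of the target of a chart, supported in a compact set, can be transported to the
source. -/
theorem IsIsotopyWithin.exists_conj {X Z : Type*} [TopologicalSpace X] [T2Space X]
    [TopologicalSpace Z] (φ : OpenPartialHomeomorph X Z) {K : Set Z} {g : Z × unitInterval → Z}
    (hg : IsIsotopyWithin K g) (hK : IsCompact K) (hKt : K ⊆ φ.target) :
    ∃ h : X × unitInterval → X, IsIsotopyWithin (φ.symm '' K) h ∧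
      ∀ x ∈ φ.source, ∀ t, h (x, t) = φ.symm (g (φ x, t)) := by
  classical
  have hgt : ∀ z ∈ φ.target, ∀ t, g (z, t) ∈ φ.target := by
    intro z hz t
    by_cases hzK : z ∈ K
    · exact hKt (hg.mapsTo t hzK)
    · rwa [hg.eq_self t z hzK]
  let h : X × unitInterval → X := fun p => if p.1 ∈ φ.source then φ.symm (g (φ p.1, p.2)) else p.1
  have h1 : ∀ x ∈ φ.source, ∀ t, h (x, t) = φ.symm (g (φ x, t)) := fun x hx t => if_pos hx
  have h2 : ∀ x ∉ φ.source, ∀ t, h (x, t) = x := fun x hx t => if_neg hx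
  have h3 : ∀ t, ∀ x ∉ φ.symm '' K, h (x, t) = x := by
    intro t x hx
    by_cases hxs : x ∈ φ.source
    · have hxK : φ x ∉ K := fun hxK => hx ⟨φ x, hxK, φ.left_inv hxs⟩
      rw [h1 x hxs, hg.eq_self t _ hxK, φ.left_inv hxs]
    · exact h2 x hxs t
  have h4 : ∀ x ∈ φ.source, ∀ t, h (x, t) ∈ φ.source := fun x hx t => by
    rw [h1 x hx]; exact φ.map_target (hgt _ (φ.map_source hx) t)
  refine ⟨h, ⟨?_, fun t => ⟨?_, ?_⟩, ?_, h3⟩, h1⟩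
  · refine continuous_iff_continuousAt.2 ?_
    rintro ⟨x, t⟩
    by_cases hxs : x ∈ φ.source
    · have hc : ContinuousAt (fun p : X × unitInterval => φ.symm (g (φ p.1, p.2))) (x, t) := by
        have e1 : ContinuousAt (fun p : X × unitInterval => (φ p.1, p.2)) (x, t) :=
          ((φ.continuousAt hxs).comp (x := (x, t)) continuousAt_fst).prodMk continuousAt_snd
        have e2 : ContinuousAt (fun p : X × unitInterval => g (φ p.1, p.2)) (x, t) :=
          hg.continuous.continuousAt.comp (x := (x, t)) e1
        exact (φ.continuousAt_symm (hgt _ (φ.map_source hxs) t)).comp (x := (x, t)) e2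
      refine hc.congr ?_
      filter_upwards [continuousAt_fst.preimage_mem_nhds (φ.open_source.mem_nhds hxs)] with p hp
      exact (h1 p.1 hp p.2).symm
    · have hcl : IsClosed (φ.symm '' K) :=
        (hK.image_of_continuousOn (φ.continuousOn_symm.mono hKt)).isClosed
      have hx : x ∈ (φ.symm '' K)ᶜ := by
        rintro ⟨z, hz, rfl⟩
        exact hxs (φ.map_target (hKt hz))
      have hc : ContinuousAt (fun p : X × unitInterval => p.1) (x, t) := continuousAt_fst
      refine hc.congr ?_
      filter_upwards [continuousAt_fst.preimage_mem_nhds (hcl.isOpen_compl.mem_nhds hx)] with p hp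
      exact (h3 p.2 p.1 hp).symm
  · intro x y hxy
    simp only at hxy
    by_cases hx : x ∈ φ.source
    · have hy : y ∈ φ.source := by
        by_contra hy
        rw [h2 y hy] at hxy
        exact hy (hxy ▸ h4 x hx t)
      rw [h1 x hx, h1 y hy] at hxy
      have := φ.symm.injOn (hgt _ (φ.map_source hx) t) (hgt _ (φ.map_source hy) t) hxy
      exact φ.injOn hx hy ((hg.bijective t).1 this)
    · by_cases hy : y ∈ φ.source
      · rw [h2 x hx] at hxy
        exact absurd (hxy ▸ h4 y hy t) hx
      · rwa [h2 x hx, h2 y hy] at hxy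
  · intro y
    by_cases hy : y ∈ φ.source
    · obtain ⟨z, hz⟩ := (hg.bijective t).2 (φ y)
      simp only at hz
      have hzt : z ∈ φ.target := by
        by_contra hzt
        rw [hg.eq_self t z fun hzK => hzt (hKt hzK)] at hz
        exact hzt (hz ▸ φ.map_source hy)
      refine ⟨φ.symm z, ?_⟩
      simp only
      rw [h1 _ (φ.map_target hzt), φ.right_inv hzt, hz, φ.left_inv hy]
    · exact ⟨y, h2 y hy t⟩
  · intro x
    by_cases hx : x ∈ φ.source
    · rw [h1 x hx, hg.map_zero, φ.left_inv hx]
    · exact h2 x hx 0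

/-- Inside a chart `φ`, let `M` lie in the slice `{x | (φ x).2 = 0}`. If `A` meets that slice inside `N`
at most in the point `q`, and `q` is a limit of points of `M \ S`, then an isotopy supported in
`N` that preserves the slice and moves `q` to a point of `M \ S` pushes `A` off `S` inside `N`.
Working with the whole slice rather than with `M` treats boundary points like interior ones. -/
theorem exists_isotopy_push {X : Type*} [TopologicalSpace X] [T2Space X] {k m : ℕ}
    (φ : OpenPartialHomeomorph X ((Fin k → ℝ) × (Fin m → ℝ))) {M S N A : Set X} {q : X}
    (hN : IsOpen N) (hqN : q ∈ N) (hNs : N ⊆ φ.source) (hqM : q ∈ M) (hSM : S ⊆ M)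
    (hM : ∀ x ∈ φ.source, x ∈ M → (φ x).2 = 0)
    (hA : ∀ x ∈ A, x ∈ N → (φ x).2 = 0 → x = q)
    (hdense : ∀ V : Set X, IsOpen V → q ∈ V → ∃ y ∈ V, y ∈ M ∧ y ∉ S) :
    ∃ h : X × unitInterval → X, IsIsotopyWithin N h ∧ ∀ x ∈ A, x ∈ N → h (x, 1) ∉ S := by
  have hqs : q ∈ φ.source := hNs hqN
  have hW : φ.target ∩ φ.symm ⁻¹' N ∈ 𝓝 (φ q) := by
    refine inter_mem (φ.open_target.mem_nhds (φ.map_source hqs)) ?_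
    refine (φ.continuousAt_symm (φ.map_source hqs)).preimage_mem_nhds ?_
    rw [φ.left_inv hqs]
    exact hN.mem_nhds hqN
  obtain ⟨s, hs, hsW⟩ := Metric.nhds_basis_closedBall.mem_iff.1 hW
  obtain ⟨y, ⟨hys, hyb⟩, hyM, hyS⟩ := hdense (φ.source ∩ φ ⁻¹' Metric.ball (φ q) s)
    (φ.isOpen_inter_preimage Metric.isOpen_ball) ⟨hqs, Metric.mem_ball_self hs⟩
  let f : (Fin k → ℝ) × (Fin m → ℝ) → ℝ := fun z => max 0 (1 - s⁻¹ * dist z (φ q))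
  have hf : LipschitzWith (Real.toNNReal s⁻¹) f := by
    refine LipschitzWith.const_max ?_ 0
    refine LipschitzWith.of_dist_le_mul fun a b => ?_
    rw [Real.coe_toNNReal _ (inv_nonneg.2 hs.le), Real.dist_eq]
    have e : 1 - s⁻¹ * dist a (φ q) - (1 - s⁻¹ * dist b (φ q)) =
        -(s⁻¹ * (dist a (φ q) - dist b (φ q))) := by ring
    rw [e, abs_neg, abs_mul, abs_of_pos (inv_pos.2 hs)]
    exact mul_le_mul_of_nonneg_left (abs_dist_sub_le a b (φ q)) (inv_nonneg.2 hs.le)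
  have ha : Real.toNNReal s⁻¹ * ‖φ y - φ q‖₊ < 1 := by
    rw [← NNReal.coe_lt_coe, NNReal.coe_mul, Real.coe_toNNReal _ (inv_nonneg.2 hs.le), coe_nnnorm,
      ← dist_eq_norm, NNReal.coe_one, inv_mul_lt_iff₀ hs, mul_one]
    exact hyb
  have hsupp : Function.support f ⊆ Metric.closedBall (φ q) s := by
    intro z hz
    by_contra hzb
    apply hz
    rw [Metric.mem_closedBall, not_le] at hzb
    refine max_eq_left ?_
    rw [sub_nonpos, ← div_eq_inv_mul, le_div_iff₀ hs, one_mul]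
    exact hzb.le
  obtain ⟨h, hh, hhs⟩ := ((isIsotopyWithin_add_smul hf ha).mono hsupp).exists_conj φ
    (isCompact_closedBall _ _) fun z hz => (hsW hz).1
  have hhN : IsIsotopyWithin N h := hh.mono (image_subset_iff.2 fun z hz => (hsW hz).2)
  refine ⟨h, hhN, fun x hxA hxN hxS => ?_⟩
  have hy0 : (φ y).2 = 0 := hM y hys hyM
  have hq0 : (φ q).2 = 0 := hM q hqs hqM
  -- The isotopy changes only the slice coordinate, so `h (x, 1) ∈ M` forces `x` into the slice.
  have hx0 : (φ x).2 = 0 := by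
    have e := hM _ (hNs (hhN.mapsTo 1 hxN)) (hSM hxS)
    have hxt : φ x + f (φ x) • (((1 : unitInterval) : ℝ) • (φ y - φ q)) ∈ φ.target := by
      by_cases hxK : φ x ∈ Metric.closedBall (φ q) s
      · exact (hsW (((isIsotopyWithin_add_smul hf ha).mono hsupp).mapsTo 1 hxK)).1
      · rw [Function.notMem_support.1 fun h' => hxK (hsupp h'), zero_smul, add_zero]
        exact φ.map_source (hNs hxN)
    rw [hhs x (hNs hxN), φ.right_inv hxt] at e
    simpa [hy0, hq0] using e
  obtain rfl := hA x hxA hxN hx0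
  have : h (x, 1) = y := by
    rw [hhs x hqs]
    simp [f, φ.left_inv hys]
  exact hyS (this ▸ hxS)

/-! ### General position of a simplex and a chart slice -/

/-- A simplex of dimension at most `n` lies in the image of an affine map `y ↦ p + L y` from `ℝ^n`
that has a continuous section over it. The map `L` need not be injective. -/
theorem exists_parametrization_convexHull {H : Type*} [NormedAddCommGroup H] [NormedSpace ℝ H]
    [FiniteDimensional ℝ H] {n : ℕ} {s : Finset H} (hs : s.Nonempty) (hcard : s.card ≤ n + 1) :
    ∃ (p : H) (L : (Fin n → ℝ) →L[ℝ] H) (R : H →L[ℝ] (Fin n → ℝ)),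
      ∀ x ∈ convexHull ℝ (s : Set H), p + L (R (x - p)) = x := by
  classical
  obtain ⟨p, hp⟩ := hs
  let W := vectorSpan ℝ (s : Set H)
  have hW : Module.finrank ℝ W ≤ Module.finrank ℝ (Fin n → ℝ) := by
    obtain ⟨c, hc⟩ : ∃ c, s.card = c + 1 :=
      ⟨s.card - 1, by have := Finset.card_pos.2 ⟨p, hp⟩; omega⟩
    have := finrank_vectorSpan_image_finset_le ℝ (id : H → H) s hc
    rw [Finset.image_id] at this
    rw [Module.finrank_fin_fun]
    exact this.trans (by omega)
  obtain ⟨i, hi⟩ := finrank_le_iff_exists_linearMap.1 hW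
  obtain ⟨g, hg⟩ := i.exists_leftInverse_of_injective (LinearMap.ker_eq_bot.2 hi)
  obtain ⟨R, hR⟩ := i.exists_extend
  refine ⟨p, LinearMap.toContinuousLinearMap (W.subtype ∘ₗ g), LinearMap.toContinuousLinearMap R,
    fun x hx => ?_⟩
  have hxW : x - p ∈ W := by
    have h1 : x ∈ affineSpan ℝ (s : Set H) := convexHull_subset_affineSpan _ hx
    have h2 := AffineSubspace.vsub_mem_direction h1 (mem_affineSpan ℝ hp)
    rwa [direction_affineSpan] at h2
  have h1 : R (x - p) = i ⟨x - p, hxW⟩ := by rw [← hR]; rfl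
  have h2 : g (i ⟨x - p, hxW⟩) = ⟨x - p, hxW⟩ := by
    rw [← LinearMap.comp_apply, hg]; rfl
  simp [h1, h2]

open MeasureTheory in
/-- Sard's theorem in equal dimensions, applied to `(u, y) ↦ f(p + L y)⁻¹ • (ψ u - (p + L y))`, where
`ψ` parametrizes the slice of the chart `φ`: the points `x = p + L y` that the motion
`x ↦ x + f x • v` carries to `ψ u` are the solutions with value `v`, and for almost every `v` these
are isolated. -/
theorem exists_null_forall_eventually_eq {H : Type*} [NormedAddCommGroup H] [NormedSpace ℝ H]
    {k n m : ℕ} (e : H ≃L[ℝ] (Fin k → ℝ) × (Fin n → ℝ))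
    (φ : OpenPartialHomeomorph H ((Fin k → ℝ) × (Fin m → ℝ)))
    (hφ : ContDiffOn ℝ ∞ φ.symm φ.target) {f : H → ℝ} (hf : ContDiff ℝ ∞ f)
    (p : H) (L : (Fin n → ℝ) →L[ℝ] H) (R : H →L[ℝ] (Fin n → ℝ)) {σ : Set H}
    (hσ : ∀ x ∈ σ, p + L (R (x - p)) = x) :
    ∃ C : Set ((Fin k → ℝ) × (Fin n → ℝ)), volume C = 0 ∧ ∀ v, e v ∉ C →
      ∀ x₀ ∈ σ, f x₀ ≠ 0 → x₀ + f x₀ • v ∈ φ.source → (φ (x₀ + f x₀ • v)).2 = 0 →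
        ∀ᶠ x in 𝓝 x₀, x ∈ σ → x + f x • v ∈ φ.source → (φ (x + f x • v)).2 = 0 → x = x₀ := by
  let G : (Fin k → ℝ) × (Fin n → ℝ) → (Fin k → ℝ) × (Fin n → ℝ) :=
    fun z => e ((f (p + L z.2))⁻¹ • (φ.symm (z.1, 0) - (p + L z.2)))
  let D : Set ((Fin k → ℝ) × (Fin n → ℝ)) :=
    {z | (z.1, (0 : Fin m → ℝ)) ∈ φ.target ∧ f (p + L z.2) ≠ 0}
  have hG : ∀ z ∈ D, DifferentiableAt ℝ G z := by
    intro z hz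
    have h1 : DifferentiableAt ℝ (fun z : (Fin k → ℝ) × (Fin n → ℝ) => f (p + L z.2)) z := by
      have := (hf.differentiable (by simp)).differentiableAt (x := p + L z.2)
      exact this.comp z (by fun_prop)
    have h2 : DifferentiableAt ℝ (fun z : (Fin k → ℝ) × (Fin n → ℝ) =>
        φ.symm (z.1, (0 : Fin m → ℝ))) z := by
      have := (hφ.differentiableOn (by simp)).differentiableAt (φ.open_target.mem_nhds hz.1)
      exact DifferentiableAt.comp z
        (f := fun z : (Fin k → ℝ) × (Fin n → ℝ) => (z.1, (0 : Fin m → ℝ))) this (by fun_prop)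
    have h3 : DifferentiableAt ℝ (fun z : (Fin k → ℝ) × (Fin n → ℝ) => (f (p + L z.2))⁻¹ •
        (φ.symm (z.1, (0 : Fin m → ℝ)) - (p + L z.2))) z :=
      (h1.inv hz.2).smul (h2.sub (by fun_prop))
    exact e.differentiableAt.comp z h3
  refine ⟨G '' {z ∈ D | (fderiv ℝ G z).det = 0}, ?_, ?_⟩
  · have : (volume : Measure ((Fin k → ℝ) × (Fin n → ℝ))).IsAddHaarMeasure :=
      Measure.prod.instIsAddHaarMeasure _ _
    exact addHaar_image_eq_zero_of_det_fderivWithin_eq_zero volume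
      (fun z hz => (hG z hz.1).hasFDerivAt.hasFDerivWithinAt) fun z hz => hz.2
  · intro v hv x₀ hx₀ hfx₀ hs₀ h0
    let Z : H → (Fin k → ℝ) × (Fin n → ℝ) := fun x => ((φ (x + f x • v)).1, R (x - p))
    have hZG : ∀ x ∈ σ, f x ≠ 0 → x + f x • v ∈ φ.source → (φ (x + f x • v)).2 = 0 →
        Z x ∈ D ∧ G (Z x) = e v := by
      intro x hx hfx hs h0
      have h1 : ((φ (x + f x • v)).1, (0 : Fin m → ℝ)) = φ (x + f x • v) := by
        rw [← h0]
      refine ⟨⟨?_, ?_⟩, ?_⟩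
      · simp only [Z, h1]; exact φ.map_source hs
      · simpa only [Z, hσ x hx] using hfx
      · simp only [G, Z, h1, hσ x hx, φ.left_inv hs, add_sub_cancel_left]
        rw [inv_smul_smul₀ hfx]
    obtain ⟨hD₀, hG₀⟩ := hZG x₀ hx₀ hfx₀ hs₀ h0
    have hdet : (fderiv ℝ G (Z x₀)).det ≠ 0 := fun h' => hv ⟨Z x₀, ⟨hD₀, h'⟩, hG₀⟩
    have hne := (hG _ hD₀).hasFDerivAt.eventually_ne (c := e v)
      ⟨_, ((fderiv ℝ G (Z x₀)).toContinuousLinearEquivOfDetNeZero hdet).antilipschitz⟩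
    rw [eventually_nhdsWithin_iff] at hne
    have hFc : ContinuousAt (fun x => x + f x • v) x₀ := by
      have := hf.continuous
      fun_prop
    have hZc : ContinuousAt Z x₀ :=
      (continuousAt_fst.comp ((φ.continuousAt hs₀).comp (f := fun x => x + f x • v) hFc)).prodMk
        (by fun_prop)
    filter_upwards [hZc.eventually hne, hf.continuous.continuousAt.eventually_ne hfx₀]
      with x hx hfx hxσ hs h0
    have hZ : Z x = Z x₀ := by
      by_contra hZ
      exact hx hZ (hZG x hxσ hfx hs h0).2
    rw [← hσ x hxσ, ← hσ x₀ hx₀]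
    exact congrArg (fun z : (Fin k → ℝ) × (Fin n → ℝ) => p + L z.2) hZ

theorem IsPolyhedron.isCompact {H : Type*} [NormedAddCommGroup H] [InnerProductSpace ℝ H]
    {n : ℕ} {P : Set H} (hP : IsPolyhedron n P) : IsCompact P := by
  obtain ⟨K, hK, rfl, -⟩ := hP
  exact hK.isCompact_biUnion fun s _ => s.finite_toSet.isCompact_convexHull ℝ

open MeasureTheory in
/-- General position of a polyhedron and a compact submanifold of complementary dimension: for
arbitrarily small `v`, every point `x₀` with `f x₀ ≠ 0` that the motion `x ↦ x + f x • v` carries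
into `M` is isolated among such points, even with the slice of some chart in place of `M`. -/
theorem exists_vector_forall_isolated {H : Type*} [NormedAddCommGroup H] [InnerProductSpace ℝ H]
    [FiniteDimensional ℝ H] {k n : ℕ} (hd : Module.finrank ℝ H = k + n) {M P : Set H}
    (hMc : IsCompact M) (hM : IsSmoothSubmanifoldWithBoundary k M) (hP : IsPolyhedron n P)
    {f : H → ℝ} (hf : ContDiff ℝ ∞ f) {δ : ℝ} (hδ : 0 < δ) :
    ∃ v : H, ‖v‖ < δ ∧ ∀ x₀ ∈ P, f x₀ ≠ 0 → x₀ + f x₀ • v ∈ M →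
      ∃ (m : ℕ) (φ : OpenPartialHomeomorph H ((Fin k → ℝ) × (Fin m → ℝ))),
        x₀ + f x₀ • v ∈ φ.source ∧ (∀ x ∈ φ.source, x ∈ M → (φ x).2 = 0) ∧
          ∀ᶠ x in 𝓝 x₀, x ∈ P → x + f x • v ∈ φ.source → (φ (x + f x • v)).2 = 0 → x = x₀ := by
  obtain ⟨K, hK, rfl, hn⟩ := hP
  let e : H ≃L[ℝ] (Fin k → ℝ) × (Fin n → ℝ) :=
    ContinuousLinearEquiv.ofFinrankEq (by rw [hd]; simp)
  choose m φ hsrc _ hsymm halt using hM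
  have hslice : ∀ q (hq : q ∈ M), ∀ x ∈ (φ q hq).source, x ∈ M → (φ q hq x).2 = 0 := by
    intro q hq x hx hxM
    rcases halt q hq with h | ⟨i, h⟩
    · exact (h x hx).1 hxM
    · exact ((h x hx).1 hxM).1
  obtain ⟨t, ht⟩ := hMc.elim_nhds_subcover' (fun q hq => (φ q hq).source)
    fun q hq => (φ q hq).open_source.mem_nhds (hsrc q hq)
  have hface : ∀ s : K.faces, ∃ (p : H) (L : (Fin n → ℝ) →L[ℝ] H) (R : H →L[ℝ] (Fin n → ℝ)),
      ∀ x ∈ convexHull ℝ (s.1 : Set H), p + L (R (x - p)) = x := by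
    rintro ⟨s, hs⟩
    have hne := K.nonempty_of_mem_faces hs
    have hc : s.card = (s.card - 1) + 1 := by have := hne.card_pos; omega
    have hle : s.card - 1 ≤ n := hn.2 ⟨s, hs, hc⟩
    exact exists_parametrization_convexHull hne (show s.card ≤ n + 1 by omega)
  choose p L R hσ using hface
  choose C hC0 hC using fun (q : M) (s : K.faces) =>
    exists_null_forall_eventually_eq e (φ q q.2) (hsymm q q.2) hf (p s) (L s) (R s) (hσ s)
  have := hK.to_subtype
  have hnull : volume (⋃ q ∈ t, ⋃ s, C q s) = 0 :=
    (measure_biUnion_null_iff t.countable_toSet).2 fun q _ => measure_iUnion_null fun s => hC0 q s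
  have hopen : IsOpen (e.symm ⁻¹' Metric.ball 0 δ) :=
    Metric.isOpen_ball.preimage e.symm.continuous
  have hpos := hopen.measure_pos volume ⟨0, by simpa using hδ⟩
  obtain ⟨w, hw, hwC⟩ : ∃ w ∈ e.symm ⁻¹' Metric.ball 0 δ, w ∉ ⋃ q ∈ t, ⋃ s, C q s := by
    by_contra! hcon
    exact hpos.ne' (measure_mono_null hcon hnull)
  refine ⟨e.symm w, by simpa using hw, fun x₀ hx₀ hfx₀ hxM => ?_⟩
  obtain ⟨q, hqt, hq⟩ := mem_iUnion₂.1 (ht hxM)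
  refine ⟨m q q.2, φ q q.2, hq, hslice q q.2, ?_⟩
  have hev : ∀ s : K.faces, ∀ᶠ x in 𝓝 x₀, x ∈ convexHull ℝ (s.1 : Set H) →
      x + f x • e.symm w ∈ (φ q q.2).source → (φ q q.2 (x + f x • e.symm w)).2 = 0 → x = x₀ := by
    intro s
    by_cases hs : x₀ ∈ convexHull ℝ (s.1 : Set H)
    · refine hC q s (e.symm w) ?_ x₀ hs hfx₀ hq (hslice q q.2 _ hq hxM)
      rw [e.apply_symm_apply]
      exact fun hwq => hwC (mem_iUnion₂.2 ⟨q, hqt, mem_iUnion.2 ⟨s, hwq⟩⟩)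
    · have hcl : IsClosed (convexHull ℝ (s.1 : Set H)) :=
        (s.1.finite_toSet.isCompact_convexHull ℝ).isClosed
      filter_upwards [hcl.isOpen_compl.mem_nhds hs] with x hx hx'
      exact absurd hx' hx
  filter_upwards [eventually_all.2 hev] with x hx hxP
  obtain ⟨s, hs, hxs⟩ := Geometry.SimplicialComplex.mem_space_iff.1 hxP
  exact hx ⟨s, hs⟩ hxs

/-! ### Pushing a polyhedron off a set with empty interior -/

/-- A polyhedron of dimension complementary to that of `M` can be pushed off any subset of `M` with
empty relative interior: a generic small motion makes its intersection with `M` discrete where it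
moves anything, and each remaining intersection point is then moved to a nearby point of `M \ S`. -/
theorem exists_isSmallIsotopy_disjoint {H : Type*} [NormedAddCommGroup H] [InnerProductSpace ℝ H]
    [FiniteDimensional ℝ H] {k n : ℕ} (hd : Module.finrank ℝ H = k + n) {M S P : Set H}
    (hMc : IsCompact M) (hM : IsSmoothSubmanifoldWithBoundary k M) (hSM : S ⊆ M)
    (hdense : ∀ q ∈ M, ∀ V : Set H, IsOpen V → q ∈ V → ∃ y ∈ V, y ∈ M ∧ y ∉ S)
    (hP : IsPolyhedron n P) {ε : ℝ} (hε : 0 < ε) :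
    ∃ F : H × unitInterval → H, IsSmallIsotopy ε (Metric.thickening ε (P ∩ S)) F ∧
      ∀ x ∈ P, F (x, 1) ∉ S := by
  have hPc := hP.isCompact
  have hUo : IsOpen (Metric.thickening ε (P ∩ S)) := Metric.isOpen_thickening
  have hUb : Bornology.IsBounded (Metric.thickening ε (P ∩ S)) :=
    (hPc.isBounded.subset inter_subset_left).thickening
  obtain ⟨f, hfU, hf, hf01⟩ := hUo.exists_contDiff_support_eq (n := ⊤)
  have hf0 : ∀ x, 0 ≤ f x := fun x => (hf01 ⟨x, rfl⟩).1
  have hf1 : ∀ x, f x ≤ 1 := fun x => (hf01 ⟨x, rfl⟩).2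
  have hfc : HasCompactSupport f := by
    refine Metric.isCompact_of_isClosed_isBounded isClosed_closure ?_
    rw [tsupport, hfU]
    exact hUb.closure
  obtain ⟨c, hc⟩ := hf.lipschitzWith_of_hasCompactSupport hfc (by simp)
  obtain ⟨v, hv, hiso⟩ := exists_vector_forall_isolated hd hMc hM hP hf
    (δ := min (ε / 2) (1 / (c + 1))) (by positivity)
  have hvε : ‖v‖ ≤ ε / 2 := (hv.trans_le (min_le_left _ _)).le
  have hcv : c * ‖v‖₊ < 1 := by
    have h1 : ‖v‖ < 1 / (c + 1) := hv.trans_le (min_le_right _ _)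
    rw [lt_div_iff₀ (by positivity)] at h1
    rw [← NNReal.coe_lt_coe, NNReal.coe_mul, coe_nnnorm, NNReal.coe_one]
    nlinarith [norm_nonneg v]
  have hF := isIsotopyWithin_add_smul hc hcv
  have hFb := hF.isHomeomorph (hfU ▸ hUb) 1
  rw [hfU] at hF
  set F : H × unitInterval → H := fun p => p.1 + f p.1 • ((p.2 : ℝ) • v) with hFdef
  have hF1 : ∀ x, F (x, 1) = x + f x • v := fun x => by simp [hFdef]
  let Φ : H ≃ₜ H := hFb.homeomorph
  have hΦ : ∀ x, Φ x = x + f x • v := hF1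
  have hΦc : Continuous Φ := Φ.continuous
  let A : Set H := Φ '' P
  let T : Set H := {x | x ∈ P ∧ f x ≠ 0 ∧ Φ x ∈ M}
  -- Only finitely many of the intersection points come from the region where `η ≤ f`.
  have hTfin : ∀ η > 0, {x ∈ T | η ≤ f x}.Finite := by
    intro η hη
    by_contra hinf
    have hsub : {x ∈ T | η ≤ f x} ⊆ P ∩ ({x | η ≤ f x} ∩ Φ ⁻¹' M) :=
      fun x hx => ⟨hx.1.1, hx.2, hx.1.2.2⟩
    have hcpt : IsCompact (P ∩ ({x | η ≤ f x} ∩ Φ ⁻¹' M)) :=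
      hPc.inter_right ((isClosed_le continuous_const hf.continuous).inter
        (hMc.isClosed.preimage hΦc))
    obtain ⟨x₀, ⟨hx₀P, hx₀f, hx₀M⟩, hacc⟩ := Set.Infinite.exists_accPt_of_subset_isCompact hinf
      hcpt hsub
    obtain ⟨m, φ, hs, hMφ, hev⟩ := hiso x₀ hx₀P (hη.trans_le hx₀f).ne' (by rw [← hΦ]; exact hx₀M)
    rw [accPt_iff_frequently] at hacc
    rw [← hΦ] at hs
    have hsrc := hΦc.continuousAt.eventually (φ.open_source.mem_nhds hs)
    obtain ⟨x, ⟨hne, hxT, -⟩, hx, hxs⟩ := (hacc.and_eventually (hev.and hsrc)).exists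
    simp only [← hΦ] at hx
    exact hne (hx hxT.1 hxs (hMφ _ hxs hxT.2.2))
  have hρ : ∀ x : T, ∃ ρ > 0, ∃ (m : ℕ)
      (φ : OpenPartialHomeomorph H ((Fin k → ℝ) × (Fin m → ℝ))),
      Metric.ball (Φ x) ρ ⊆ φ.source ∧ Metric.ball (Φ x) ρ ⊆ Metric.thickening ε (P ∩ S) ∧
        (∀ y ∈ φ.source, y ∈ M → (φ y).2 = 0) ∧
        ∀ y ∈ A, y ∈ Metric.ball (Φ x) ρ → (φ y).2 = 0 → y = Φ x := by
    rintro ⟨x, hxP, hfx, hxM⟩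
    obtain ⟨m, φ, hs, hMφ, hev⟩ := hiso x hxP hfx (by rw [← hΦ]; exact hxM)
    simp only [← hΦ] at hs hev
    have hxU : Φ x ∈ Metric.thickening ε (P ∩ S) :=
      hF.mapsTo 1 (by rw [← hfU]; exact hfx)
    have hev' : ∀ᶠ y in 𝓝 (Φ x), Φ.symm y ∈ P → y ∈ φ.source → (φ y).2 = 0 → y = Φ x := by
      have hcs : Tendsto Φ.symm (𝓝 (Φ x)) (𝓝 x) := by
        have := Φ.symm.continuous.continuousAt (x := Φ x)
        rwa [ContinuousAt, Φ.symm_apply_apply] at this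
      filter_upwards [hcs.eventually hev] with y hy h1 h2 h3
      rw [Φ.apply_symm_apply] at hy
      rw [← hy h1 h2 h3, Φ.apply_symm_apply]
    obtain ⟨ρ, hρ, hball⟩ := Metric.mem_nhds_iff.1
      (inter_mem (inter_mem (φ.open_source.mem_nhds hs) (hUo.mem_nhds hxU)) hev')
    refine ⟨ρ, hρ, m, φ, fun y hy => (hball hy).1.1, fun y hy => (hball hy).1.2, hMφ, ?_⟩
    rintro y ⟨z, hz, rfl⟩ hy h0
    exact (hball hy).2 (by rwa [Φ.symm_apply_apply]) (hball hy).1.1 h0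
  choose ρ hρ m φ hρs hρU hMφ hρA using hρ
  have hfpos : ∀ x : T, 0 < f x := fun x => (hf0 x).lt_of_ne' x.2.2.1
  let r : T → ℝ := fun x => min (ρ x / 2) (min (f x / 2) (ε / 4))
  have hr0 : ∀ x, 0 < r x := fun x =>
    lt_min (half_pos (hρ x)) (lt_min (half_pos (hfpos x)) (by positivity))
  have hrρ : ∀ x, r x ≤ ρ x / 2 := fun x => min_le_left _ _
  have hrf : ∀ x, r x ≤ f x / 2 := fun x => (min_le_right _ _).trans (min_le_left _ _)
  have hrε : ∀ x, r x ≤ ε / 4 := fun x => (min_le_right _ _).trans (min_le_right _ _)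
  have hsub : ∀ x : T, Metric.ball (Φ x) (r x) ⊆ Metric.ball (Φ x) (ρ x) := fun x =>
    Metric.ball_subset_ball (by linarith [hrρ x, hρ x])
  have hpush : ∀ x : T, ∃ h : H × unitInterval → H, IsIsotopyWithin (Metric.ball (Φ x) (r x)) h ∧
      ∀ y ∈ A, y ∈ Metric.ball (Φ x) (r x) → h (y, 1) ∉ S := fun x =>
    exists_isotopy_push (φ x) Metric.isOpen_ball (Metric.mem_ball_self (hr0 x))
      ((hsub x).trans (hρs x)) x.2.2.2 hSM (hMφ x)
      (fun y hyA hy => hρA x y hyA (hsub x hy)) (hdense _ x.2.2.2)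
  choose h hh hhS using hpush
  have hsep : ∀ x y : T, dist (Φ y) (Φ x) < ρ x → x = y := by
    intro x y hxy
    have hy : Φ y ∈ Metric.ball (Φ x) (ρ x) := hxy
    exact (Subtype.ext (Φ.injective
      (hρA x _ ⟨y, y.2.1, rfl⟩ hy (hMφ x _ (hρs x hy) y.2.2.2)))).symm
  obtain ⟨G, hG, hGh⟩ := IsIsotopyWithin.exists_glue (fun x : T => Metric.ball (Φ x) (r x)) h hh
    (by
      intro x y z hx hy
      rw [Metric.mem_ball] at hx hy
      have h1 := dist_triangle_left (Φ x) (Φ y) z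
      rcases le_total (ρ x) (ρ y) with hle | hle
      · exact (hsep y x (by linarith [hrρ x, hrρ y])).symm
      · exact hsep x y (by rw [dist_comm]; linarith [hrρ x, hrρ y]))
    (fun x => 2 * r x)
    (by
      intro x y hy z hz
      rw [Metric.mem_ball] at hy hz
      linarith [dist_triangle_right y z (Φ x)])
    (by
      intro η hη
      refine ((hTfin η hη).preimage Subtype.val_injective.injOn).subset fun x hx => ?_
      have hx' : η ≤ 2 * r x := hx
      exact ⟨x.2, by linarith [hrf x]⟩)
  have hNU : (⋃ x : T, Metric.ball (Φ x) (r x)) ⊆ Metric.thickening ε (P ∩ S) :=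
    iUnion_subset fun x => (hsub x).trans (hρU x)
  have hGF := (hG.mono hNU).comp hF
  refine ⟨_, ⟨hGF.continuous, hGF.isHomeomorph hUb, hGF.map_zero, ?_, hGF.eq_self⟩, ?_⟩
  · intro t x
    have h1 : dist x (F (x, t)) ≤ ε / 2 := by
      have ht : ‖(t : ℝ)‖ ≤ 1 := by rw [Real.norm_eq_abs, abs_of_nonneg t.2.1]; exact t.2.2
      have hfx : ‖f x‖ ≤ 1 := by rw [Real.norm_eq_abs, abs_of_nonneg (hf0 x)]; exact hf1 x
      rw [hFdef, dist_self_add_right, norm_smul, norm_smul]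
      calc ‖f x‖ * (‖(t : ℝ)‖ * ‖v‖) ≤ 1 * (1 * ‖v‖) := by gcongr
        _ ≤ ε / 2 := by linarith
    have h2 : ∀ y, dist y (G (y, t)) ≤ ε / 2 := by
      intro y
      by_cases hy : y ∈ ⋃ x : T, Metric.ball (Φ x) (r x)
      · obtain ⟨x, hx⟩ := mem_iUnion.1 hy
        have hx' := (hh x).mapsTo t hx
        rw [← hGh x y hx] at hx'
        rw [Metric.mem_ball] at hx hx'
        linarith [dist_triangle_right y (G (y, t)) (Φ x), hrε x]
      · rw [hG.eq_self t y hy, dist_self]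
        positivity
    linarith [dist_triangle x (F (x, t)) (G (F (x, t), t)), h2 (F (x, t))]
  · intro x hxP hxS
    change G (Φ x, 1) ∈ S at hxS
    by_cases hy : Φ x ∈ ⋃ x : T, Metric.ball (Φ x) (r x)
    · obtain ⟨z, hz⟩ := mem_iUnion.1 hy
      rw [hGh z _ hz] at hxS
      exact hhS z _ ⟨x, hxP, rfl⟩ hz hxS
    · rw [hG.eq_self 1 _ hy] at hxS
      by_cases hfx : f x = 0
      · have hxx : Φ x = x := by rw [hΦ, hfx, zero_smul, add_zero]
        rw [hxx] at hxS
        have hxU := Metric.self_subset_thickening hε _ (show x ∈ P ∩ S from ⟨hxP, hxS⟩)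
        rw [← hfU] at hxU
        exact hxU hfx
      · exact hy (mem_iUnion.2 ⟨⟨x, hxP, hfx, hSM hxS⟩, Metric.mem_ball_self (hr0 _)⟩)

theorem theorem3p7 {H : Type*} [NormedAddCommGroup H] [InnerProductSpace ℝ H]
    [FiniteDimensional ℝ H] (k : ℕ) (M S : Set H)
    (hMcompact : IsCompact M) (hM : IsSmoothSubmanifoldWithBoundary k M)
    (hSM : S ⊆ M) (hS : HasDemension S (k : ℤ)) :
    (interior {x : M | (x : H) ∈ S}).Nonempty := by
  by_contra hint
  rw [Set.not_nonempty_iff_eq_empty, interior_eq_empty_iff_dense_compl] at hint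
  obtain ⟨n, P, ε, hn, hP, hε, hmeet⟩ := hS.1
  have hd : Module.finrank ℝ H = k + n := by omega
  obtain ⟨F, hF, hFS⟩ := exists_isSmallIsotopy_disjoint hd hMcompact hM hSM
    (fun q hq V hV hqV => by
      obtain ⟨y, hy, hyV⟩ := hint.exists_mem_open (hV.preimage continuous_subtype_val)
        ⟨⟨q, hq⟩, hqV⟩
      exact ⟨y, hyV, y.2, hy⟩) hP hε
  obtain ⟨_, ⟨x, hx, rfl⟩, hxS⟩ := hmeet F hF
  exact hFS x hx hxS
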